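/- Let $n \ge 1$ be an integer and write points of $\mathbb{R}^n \times \mathbb{R}$ as $g = (x,u)$, $g' = (x',u')$. Consider the vector fields $$X_i = \frac{\partial}{\partial x_i}, \qquad U_i = x_i \frac{\partial}{\partial u}, \qquad 1 \le i \le n,$$ of the Grushin operator $\Delta_G = \sum_{i=1}^n (X_i^2 + U_i^2)$, and let $d_{CC}$ be the associated Carnot–Carathéodory distance: $d_{CC}(g,g')$ is the infimum of $$\int_0^1 \Big( \sum_{i=1}^n \big(a_i(t)^2 + b_i(t)^2\big) \Big)^{1/2} dt$$ over all absolutely continuous curves $\gamma : [0,1] \to \mathbb{R}^n \times \mathbb{R}$ with $\gamma(0) = g$, $\gamma(1) = g'$ and all measurable functions $a_i, b_i$ such that $\gamma'(t) = \sum_{i=1}^n \big(a_i(t) X_i(\gamma(t)) + b_i(t) U_i(\gamma(t))\big)$ for almost every $t \in [0,1]$. Define also $$d_K(g,g') = \Big( \sqrt{(|x|^2+|x'|^2)^2 + (2|u-u'|)^2} - 2\, x \cdot x' \Big)^{1/2},$$ where $|\cdot|$ and $x \cdot x'$ are the Euclidean norm and scalar product. Then $$d_K(g,g') \le d_{CC}(g,g')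 \qquad \text{for all } g, g' \in \mathbb{R}^n \times \mathbb{R}.$$ -/

import Mathlib

open MeasureTheory Set
open scoped ENNReal

/-- `IsHorizontal Z γ c`: the curve `γ : [0, 1] → V` is absolutely continuous and, for almost every
`t ∈ [0, 1]`, its velocity is `γ'(t) = ∑ i, c i t • Z i (γ t)`, the coefficients `c i` being
measurable. (Values of `γ` and `c` outside `[0, 1]` are irrelevant.) -/
structure IsHorizontal {ι V : Type*} [Fintype ι] [NormedAddCommGroup V] [NormedSpace ℝ V]
    (Z : ι → V → V) (γ : ℝ → V) (c : ι → ℝ → ℝ) : Prop where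
  absolutelyContinuous : AbsolutelyContinuousOnInterval γ 0 1
  measurable : ∀ i, Measurable (c i)
  velocity : ∀ᵐ t ∂(volume.restrict (Icc (0 : ℝ) 1)), HasDerivAt γ (∑ i, c i t • Z i (γ t)) t

/-- The length `∫₀¹ (∑ i, c i t ^ 2) ^ (1/2) dt ∈ [0, ∞]` of a horizontal curve with
coefficients `c`. -/
noncomputable def horizontalLength {ι : Type*} [Fintype ι] (c : ι → ℝ → ℝ) : ℝ≥0∞ :=
  ∫⁻ t in Icc (0 : ℝ) 1, ENNReal.ofReal (√(∑ i, c i t ^ 2))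

/-- The Carnot–Carathéodory distance associated with the family of vector fields `Z`: the infimum
of the lengths of the horizontal curves from `p` to `q` (`∞` if there is no such curve). -/
noncomputable def carnotCaratheodoryDist {ι V : Type*} [Fintype ι] [NormedAddCommGroup V]
    [NormedSpace ℝ V] (Z : ι → V → V) (p q : V) : ℝ≥0∞ :=
  ⨅ (γ : ℝ → V) (c : ι → ℝ → ℝ) (_ : IsHorizontal Z γ c) (_ : γ 0 = p) (_ : γ 1 = q),
    horizontalLength c

/-- The space `ℝⁿ × ℝ`, with points `g = (x, u)`. It is used only as a finite-dimensional real
vector space, so the choice of the norm on the product does not matter. -/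
abbrev GrushinSpace (n : ℕ) : Type := EuclideanSpace ℝ (Fin n) × ℝ

/-- The vector fields of the Grushin operator: `Sum.inl i` gives `X_i = ∂/∂x_i` and
`Sum.inr i` gives `U_i = x_i ∂/∂u`. -/
noncomputable def grushinField (n : ℕ) : Fin n ⊕ Fin n → GrushinSpace n → GrushinSpace n
  | Sum.inl i, _ => (EuclideanSpace.single i 1, 0)
  | Sum.inr i, g => (0, g.1 i)

/-- The Carnot–Carathéodory distance `d_CC` of the Grushin operator. -/
noncomputable def grushinDCC {n : ℕ} (g g' : GrushinSpace n) : ℝ≥0∞ :=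
  carnotCaratheodoryDist (grushinField n) g g'

/-- The pseudo-distance `d_K((x, u), (x', u')) = (√(R⁴ + (2 s)²) - 2 x · x')^{1/2}`, where
`R² = |x|² + |x'|²` and `s = |u - u'|`. -/
noncomputable def grushinDK {n : ℕ} (g g' : GrushinSpace n) : ℝ :=
  √(√((‖g.1‖ ^ 2 + ‖g'.1‖ ^ 2) ^ 2 + (2 * |g.2 - g'.2|) ^ 2) - 2 * inner ℝ g.1 g'.1)

open Filter Topology

/-! A `C¹` function with horizontal gradient of norm at most `1` grows along a horizontal curve by
at most its length. The function `p ↦ grushinDK p q` formally satisfies this bound but is not smooth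
everywhere, so `ε ^ 2` is added under the inner root. With `N` the inner root, `F = N - 2 x · y`, `A
= (|x|² + |y|²) / N` and `B = 2 (u - u') / N`, the horizontal gradient is `(A x - y, B x) / √F`.
Since `A² + B² ≤ 1`, its squared norm is at most `A F / F = A ≤ 1`. Then `ε → 0`. -/

/-- A locally Lipschitz function of an absolutely continuous curve is absolutely continuous. -/
theorem LocallyLipschitz.comp_absolutelyContinuousOnInterval {V W : Type*}
    [PseudoMetricSpace W] [NormedAddCommGroup V] {f : V → W}
    (hf : LocallyLipschitz f) {γ : ℝ → V} {a b : ℝ} (hγ : AbsolutelyContinuousOnInterval γ a b) :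
    AbsolutelyContinuousOnInterval (f ∘ γ) a b := by
  obtain ⟨K, hK⟩ := (hf.locallyLipschitzOn (s := γ '' uIcc a b)).exists_lipschitzOnWith_of_compact
    (isCompact_uIcc.image_of_continuousOn hγ.continuousOn)
  rw [absolutelyContinuousOnInterval_iff] at hγ ⊢
  intro ε hε
  -- `K + 1` rather than `K`, since `K` may vanish.
  obtain ⟨δ, hδ, h⟩ := hγ (ε / (K + 1)) (by positivity)
  refine ⟨δ, hδ, fun E hE hEδ => ?_⟩
  have hlt := h E hE hEδ
  rw [lt_div_iff₀ (by positivity)] at hlt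
  refine lt_of_le_of_lt ?_ hlt
  rw [Finset.sum_mul]
  refine Finset.sum_le_sum fun i hi => ?_
  have hle := hK.dist_le_mul _ (mem_image_of_mem γ (hE.1 i hi).1) _
    (mem_image_of_mem γ (hE.1 i hi).2)
  simp only [Function.comp_apply]
  nlinarith [dist_nonneg (x := γ (E.2 i).1) (y := γ (E.2 i).2)]

/-- A `C¹` function whose horizontal gradient has norm at most `1` is `1`-Lipschitz for the
Carnot–Carathéodory distance. -/
theorem enorm_sub_le_carnotCaratheodoryDist {ι V : Type*} [Fintype ι] [NormedAddCommGroup V]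
    [NormedSpace ℝ V] {Z : ι → V → V} {f : V → ℝ} (hf : ContDiff ℝ 1 f)
    (hZ : ∀ p (c : ι → ℝ), |fderiv ℝ f p (∑ i, c i • Z i p)| ≤ √(∑ i, c i ^ 2)) (p q : V) :
    ‖f q - f p‖ₑ ≤ carnotCaratheodoryDist Z p q := by
  refine le_iInf fun γ => le_iInf fun c => le_iInf fun hγ => le_iInf fun h0 => le_iInf fun h1 => ?_
  have hac := hf.locallyLipschitz.comp_absolutelyContinuousOnInterval hγ.absolutelyContinuous
  have hint := hac.integral_deriv_eq_sub
  rw [Function.comp_apply, Function.comp_apply, h0, h1,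
    intervalIntegral.integral_of_le zero_le_one, ← integral_Icc_eq_integral_Ioc] at hint
  rw [← hint]
  refine (enorm_integral_le_lintegral_enorm _).trans (lintegral_mono_ae ?_)
  filter_upwards [hγ.velocity] with t ht
  have hd := ((hf.differentiable one_ne_zero (γ t)).hasFDerivAt.comp_hasDerivAt t ht).deriv
  rw [hd, Real.enorm_eq_ofReal_abs]
  exact ENNReal.ofReal_le_ofReal (hZ _ _)

/-- A smooth approximation, with parameter `ε`, of `p ↦ grushinDK p q`. -/
noncomputable def grushinDKReg {n : ℕ} (ε : ℝ) (q p : GrushinSpace n) : ℝ :=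
  √(√((‖p.1‖ ^ 2 + ‖q.1‖ ^ 2) ^ 2 + (2 * (p.2 - q.2)) ^ 2 + ε ^ 2) - 2 * inner ℝ p.1 q.1)

/-- This keeps the outer radicand positive, so that the outer root is smooth even at `p = q`. -/
theorem two_mul_inner_lt_sqrt {E : Type*} [NormedAddCommGroup E] [InnerProductSpace ℝ E]
    (x y : E) (s : ℝ) {ε : ℝ} (hε : 0 < ε) :
    2 * inner ℝ x y < √((‖x‖ ^ 2 + ‖y‖ ^ 2) ^ 2 + s ^ 2 + ε ^ 2) := by
  have h : 2 * inner ℝ x y ≤ ‖x‖ ^ 2 + ‖y‖ ^ 2 := by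
    nlinarith [norm_sub_sq_real x y, sq_nonneg ‖x - y‖]
  exact h.trans_lt (Real.lt_sqrt_of_sq_lt (by nlinarith [sq_nonneg s, pow_pos hε 2]))

theorem contDiff_grushinDKReg {n : ℕ} {ε : ℝ} (hε : 0 < ε) (q : GrushinSpace n) :
    ContDiff ℝ 1 (grushinDKReg ε q) := by
  unfold grushinDKReg
  refine ContDiff.sqrt (ContDiff.sub (ContDiff.sqrt ?_ fun p => ?_) ?_) fun p => ?_
  · exact ((((contDiff_fst.norm_sq ℝ).add contDiff_const).pow 2).add
      ((contDiff_const.mul (contDiff_snd.sub contDiff_const)).pow 2)).add contDiff_const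
  · positivity
  · exact contDiff_const.mul (contDiff_fst.inner ℝ contDiff_const)
  · exact (sub_pos.2 (two_mul_inner_lt_sqrt _ _ _ hε)).ne'

/-- The algebraic inequality behind the bound on the horizontal gradient. -/
theorem abs_horizontal_derivative_le {E : Type*} [NormedAddCommGroup E] [InnerProductSpace ℝ E]
    (x y a b : E) {A B : ℝ} (hA : 0 ≤ A) (hAB : A ^ 2 + B ^ 2 ≤ 1) {F : ℝ} (hF : 0 ≤ F)
    (hAF : ‖x‖ ^ 2 + ‖y‖ ^ 2 - 2 * A * inner ℝ x y = A * F) :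
    |inner ℝ (A • x - y) a + B * inner ℝ x b| ≤ √F * √(‖a‖ ^ 2 + ‖b‖ ^ 2) := by
  have hA1 : A ≤ 1 := by nlinarith [sq_nonneg B]
  have h1 := abs_real_inner_le_norm (A • x - y) a
  have h2 := abs_real_inner_le_norm x b
  -- Expanding, `(A² + B²)|x|² + |y|² - 2A x · y ≤ |x|² + |y|² - 2A x · y = A F ≤ F`.
  have h3 : ‖A • x - y‖ ^ 2 + (|B| * ‖x‖) ^ 2 ≤ F := by
    rw [norm_sub_sq_real, norm_smul, real_inner_smul_left, mul_pow, mul_pow, Real.norm_eq_abs,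
      sq_abs, sq_abs]
    nlinarith [mul_le_mul_of_nonneg_right hAB (sq_nonneg ‖x‖), mul_le_mul_of_nonneg_right hA1 hF]
  rw [← Real.sqrt_mul hF]
  apply Real.le_sqrt_of_sq_le
  have h4 : |inner ℝ (A • x - y) a + B * inner ℝ x b| ≤
      ‖A • x - y‖ * ‖a‖ + (|B| * ‖x‖) * ‖b‖ := by
    refine (abs_add_le _ _).trans (add_le_add h1 ?_)
    rw [abs_mul, mul_assoc]
    exact mul_le_mul_of_nonneg_left h2 (abs_nonneg B)
  calc _ ≤ (‖A • x - y‖ * ‖a‖ + (|B| * ‖x‖) * ‖b‖) ^ 2 := by gcongr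
    -- Cauchy–Schwarz in the plane, from Lagrange's identity.
    _ ≤ (‖A • x - y‖ ^ 2 + (|B| * ‖x‖) ^ 2) * (‖a‖ ^ 2 + ‖b‖ ^ 2) := by
      nlinarith [sq_nonneg (‖A • x - y‖ * ‖b‖ - (|B| * ‖x‖) * ‖a‖)]
    _ ≤ _ := by gcongr

theorem sum_smul_grushinField {n : ℕ} (c : Fin n ⊕ Fin n → ℝ) (p : GrushinSpace n) :
    ∑ i, c i • grushinField n i p =
      (WithLp.toLp 2 fun i => c (Sum.inl i),
        inner ℝ p.1 (WithLp.toLp 2 fun i => c (Sum.inr i))) := by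
  rw [Fintype.sum_sum_type]
  ext j
  · simp [grushinField, Prod.fst_sum, Pi.single_apply]
  · simp [grushinField, Prod.snd_sum, PiLp.inner_apply]

theorem fderiv_grushinDKReg {n : ℕ} {ε : ℝ} (hε : 0 < ε) (q p : GrushinSpace n)
    (a : EuclideanSpace ℝ (Fin n)) (w : ℝ) {N : ℝ}
    (hN : N = √((‖p.1‖ ^ 2 + ‖q.1‖ ^ 2) ^ 2 + (2 * (p.2 - q.2)) ^ 2 + ε ^ 2)) :
    fderiv ℝ (grushinDKReg ε q) p (a, w) =
      (inner ℝ (((‖p.1‖ ^ 2 + ‖q.1‖ ^ 2) / N) • p.1 - q.1) a + 2 * (p.2 - q.2) / N * w) /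
        √(N - 2 * inner ℝ p.1 q.1) := by
  have hpos := sub_pos.2 (two_mul_inner_lt_sqrt p.1 q.1 (2 * (p.2 - q.2)) hε)
  have hx : HasFDerivAt (fun p : GrushinSpace n => p.1) (ContinuousLinearMap.fst ℝ _ _) p :=
    hasFDerivAt_fst
  have hu : HasFDerivAt (fun p : GrushinSpace n => p.2) (ContinuousLinearMap.snd ℝ _ _) p :=
    hasFDerivAt_snd
  have hR : 0 < (‖p.1‖ ^ 2 + ‖q.1‖ ^ 2) ^ 2 + (2 * (p.2 - q.2)) ^ 2 + ε ^ 2 := by positivity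
  have h := ((((((hx.norm_sq.add_const (‖q.1‖ ^ 2)).pow 2).add
    (((hu.sub_const q.2).const_mul 2).pow 2)).add_const (ε ^ 2)).sqrt hR.ne').sub
      ((hx.inner ℝ (hasFDerivAt_const q.1 p)).const_mul 2)).sqrt hpos.ne'
  have hN0 : 0 < N := hN ▸ Real.sqrt_pos.2 hR
  have hF0 : 0 < √(N - 2 * inner ℝ p.1 q.1) := Real.sqrt_pos.2 (hN ▸ hpos)
  have h' : HasFDerivAt (grushinDKReg ε q) _ p := h
  rw [h'.fderiv]
  simp only [Pi.add_apply, Pi.sub_apply, ← hN]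
  simp [inner_sub_left, real_inner_smul_left, real_inner_comm a q.1]
  field_simp
  ring

theorem abs_fderiv_grushinDKReg_le {n : ℕ} {ε : ℝ} (hε : 0 < ε) (q p : GrushinSpace n)
    (c : Fin n ⊕ Fin n → ℝ) :
    |fderiv ℝ (grushinDKReg ε q) p (∑ i, c i • grushinField n i p)| ≤ √(∑ i, c i ^ 2) := by
  obtain ⟨N, hN⟩ : ∃ N, N = √((‖p.1‖ ^ 2 + ‖q.1‖ ^ 2) ^ 2 + (2 * (p.2 - q.2)) ^ 2 + ε ^ 2) :=
    ⟨_, rfl⟩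
  have hpos := sub_pos.2 (two_mul_inner_lt_sqrt p.1 q.1 (2 * (p.2 - q.2)) hε)
  rw [← hN] at hpos
  have hN0 : 0 < N := hN ▸ Real.sqrt_pos.2 (by positivity)
  have hN2 : N ^ 2 = (‖p.1‖ ^ 2 + ‖q.1‖ ^ 2) ^ 2 + (2 * (p.2 - q.2)) ^ 2 + ε ^ 2 := by
    rw [hN, Real.sq_sqrt (by positivity)]
  rw [sum_smul_grushinField, fderiv_grushinDKReg hε q p _ _ hN, abs_div,
    abs_of_pos (Real.sqrt_pos.2 hpos), div_le_iff₀' (Real.sqrt_pos.2 hpos)]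
  have hc : ∑ i, c i ^ 2 = ‖WithLp.toLp 2 fun i => c (Sum.inl i)‖ ^ 2 +
      ‖WithLp.toLp 2 fun i => c (Sum.inr i)‖ ^ 2 := by
    simp [Fintype.sum_sum_type, EuclideanSpace.real_norm_sq_eq]
  rw [hc]
  refine abs_horizontal_derivative_le _ _ _ _ (by positivity) ?_ hpos.le ?_
  -- Here `A² + B² = 1 - ε² / N²`.
  · rw [div_pow, div_pow, ← add_div, div_le_one (by positivity), hN2]
    nlinarith [sq_nonneg ε]
  · field_simp

theorem tendsto_grushinDKReg {n : ℕ} (q p : GrushinSpace n) :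
    Tendsto (fun ε => grushinDKReg ε q p) (𝓝[>] 0) (𝓝 (grushinDK p q)) := by
  have h0 : grushinDKReg 0 q p = grushinDK p q := by
    simp [grushinDKReg, grushinDK, mul_pow]
  rw [← h0]
  have hc : Continuous fun ε => grushinDKReg ε q p := by
    unfold grushinDKReg
    fun_prop
  exact hc.continuousWithinAt

theorem grushinDK_self {n : ℕ} (p : GrushinSpace n) : grushinDK p p = 0 := by
  have h : √((‖p.1‖ ^ 2 + ‖p.1‖ ^ 2) ^ 2) = ‖p.1‖ ^ 2 + ‖p.1‖ ^ 2 := Real.sqrt_sq (by positivity)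
  simp [grushinDK, h, two_mul]

theorem grushinDK_comm {n : ℕ} (p q : GrushinSpace n) : grushinDK p q = grushinDK q p := by
  simp only [grushinDK, add_comm (‖p.1‖ ^ 2), abs_sub_comm p.2, real_inner_comm p.1]

theorem proposition5p1 (n : ℕ) (hn : 1 ≤ n) (g g' : GrushinSpace n) :
    ENNReal.ofReal (grushinDK g g') ≤ grushinDCC g g' := by
  -- The value at `g` is subtracted because the regularization vanishes there only in the limit.
  have h : Tendsto (fun ε => ‖grushinDKReg ε g g' - grushinDKReg ε g g‖ₑ) (𝓝[>] 0)
      (𝓝 ‖grushinDK g' g - grushinDK g g‖ₑ) :=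
    ((tendsto_grushinDKReg g g').sub (tendsto_grushinDKReg g g)).enorm
  rw [grushinDK_self, sub_zero, grushinDK_comm, Real.enorm_eq_ofReal (show 0 ≤ grushinDK g g' from Real.sqrt_nonneg _)] at h
  refine le_of_tendsto h ?_
  filter_upwards [self_mem_nhdsWithin] with ε hε
  exact enorm_sub_le_carnotCaratheodoryDist (contDiff_grushinDKReg hε g)
    (abs_fderiv_grushinDKReg_le hε g) g g'
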